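/- Let $G$ be a locally compact (Hausdorff) abelian group whose Haar measure $\mu$ satisfies $\mu(G)<\infty$, let $1<p<\infty$, $\theta\ge 0$, and write $q'$ for the exponent conjugate to $q$, i.e. $\frac1q+\frac1{q'}=1$ (with $1'=\infty$). For a measurable function $g:G\to\mathbb R$ put $$\|g\|_{(p',\theta}=\inf_{g=\sum_{k=1}^\infty g_k}\ \sum_{k=1}^\infty\ \inf_{0<\varepsilon\le p-1}\varepsilon^{-\frac{\theta}{p-\varepsilon}}\,\|g_k\|_{L^{(p-\varepsilon)'}(\mu)},$$ where the outer infimum is over all decompositions $g=\sum_k g_k$ a.e. into measurable real-valued functions $g_k$, and let the small Lebesgue space $L^{(p',\theta}(G)$ consist of all (classes of) measurable $g$ with $\|g\|_{(p',\theta}<\infty$. Then $L^{(p',\theta}(G)$ admits an approximate identity bounded in $L^1(G)$: there are a net $(e_\alpha)_{\alpha\in I}$ in $L^{(p',\theta}(G)$, indexed by a nonempty directed set, and a constant $C<\infty$ such that $\|e_\alpha\|_{L^1(\mu)}\le C$ for all $\alpha\in I$ and, for every $f\in L^{(p',\theta}(G)$, the convolutions $e_\alpha*f$ are defined a.e. and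 belong to $L^{(p',\theta}(G)$, and $$\lim_{\alpha}\ \|e_\alpha*f-f\|_{(p',\theta}=0 .$$ -/

import Mathlib

open MeasureTheory Filter Topology
open scoped ENNReal NNReal

universe u

noncomputable section

/-- `inf_{0 < ε ≤ p - 1} ε ^ (-θ / (p - ε)) ‖g‖_{(p - ε)'}`, where `q'` is the exponent conjugate
to `q`. At `ε = p - 1` the exponent `(p - ε)'` is `∞` and the norm is the essential supremum. -/
def smallLebesgueGauge {Ω : Type*} [MeasurableSpace Ω] (p θ : ℝ) (μ : Measure Ω) (g : Ω → ℝ) :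
    ℝ≥0∞ :=
  ⨅ ε ∈ Set.Ioc (0 : ℝ) (p - 1),
    ENNReal.ofReal (ε ^ (-θ / (p - ε))) *
      eLpNorm g (ENNReal.conjExponent (ENNReal.ofReal (p - ε))) μ

/-- The (extended) norm of the small Lebesgue space `L^{(p',θ}(Ω, μ)`, `p' = p / (p - 1)`: the
infimum of `∑ₖ smallLebesgueGauge (gₖ)` over all decompositions `g = ∑ₖ gₖ` (almost everywhere)
into measurable real functions. On a finite measure space a decomposition whose sum of gauges is
finite converges absolutely almost everywhere, so the mode of convergence plays no role. -/
def smallLebesgueNorm {Ω : Type*} [MeasurableSpace Ω] (p θ : ℝ) (μ : Measure Ω) (g : Ω → ℝ) :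
    ℝ≥0∞ :=
  ⨅ (u : ℕ → Ω → ℝ) (_ : ∀ k, AEStronglyMeasurable (u k) μ)
    (_ : ∀ᵐ x ∂μ, HasSum (fun k => u k x) (g x)),
    ∑' k, smallLebesgueGauge p θ μ (u k)

/-- Membership in the small Lebesgue space `L^{(p',θ}(Ω, μ)`. -/
def MemSmallLebesgue {Ω : Type*} [MeasurableSpace Ω] (p θ : ℝ) (μ : Measure Ω) (g : Ω → ℝ) :
    Prop :=
  AEStronglyMeasurable g μ ∧ smallLebesgueNorm p θ μ g < ∞

/-- Convolution `(f * g)(x) = ∫ f(t) g(x - t) dμ(t)` of real functions on an additive group. -/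
def groupConv {G : Type*} [AddCommGroup G] [MeasurableSpace G] (μ : Measure G) (f g : G → ℝ) :
    G → ℝ :=
  convolution f g (ContinuousLinearMap.mul ℝ ℝ) μ

/-- The net `e` is an approximate identity of `L^{(p',θ}(G)` that is bounded in `L¹(G)`. -/
structure IsSmallLebesgueApproxIdentity {G : Type*} [AddCommGroup G] [MeasurableSpace G]
    (p θ : ℝ) (μ : Measure G) {I : Type*} [Preorder I] (e : I → G → ℝ) : Prop where
  mem : ∀ i, MemSmallLebesgue p θ μ (e i)
  bounded : ∃ C : ℝ≥0, ∀ i, eLpNorm (e i) 1 μ ≤ C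
  conv_exists : ∀ f, MemSmallLebesgue p θ μ f → ∀ i,
    ∀ᵐ x ∂μ, ConvolutionExistsAt (e i) f x (ContinuousLinearMap.mul ℝ ℝ) μ
  conv_mem : ∀ f, MemSmallLebesgue p θ μ f → ∀ i, MemSmallLebesgue p θ μ (groupConv μ (e i) f)
  tendsto : ∀ f, MemSmallLebesgue p θ μ f →
    Tendsto (fun i => smallLebesgueNorm p θ μ (groupConv μ (e i) f - f)) atTop (𝓝 0)

end

/-!
A locally compact group of finite Haar measure is compact, so each neighbourhood of `0` carries a
continuous probability density, and these densities form a Dirac net `e`. By Young's inequality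
`e i * u - u` is at most twice `u` in every `L^q`, hence also in the gauge, whatever its infimum
over `ε` does. A function of finite gauge lies in some `L^q` with `q < ∞`, where continuous
functions are dense, so there `e i * u → u`, and therefore also in the gauge. Finally, the small
Lebesgue space embeds into `L¹`, so convolution with `e i` passes through a decomposition
`f = ∑ₖ uₖ`, and dominated convergence for series gives `e i * f → f`.
-/

section Density

variable {X : Type*} [TopologicalSpace X] [MeasurableSpace X] [BorelSpace X] {μ : Measure X}

lemma integrable_of_continuous [CompactSpace X] [IsFiniteMeasureOnCompacts μ] {f : X → ℝ}
    (hf : Continuous f) : Integrable f μ :=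
  hf.integrable_of_hasCompactSupport (.of_compactSpace f)

lemma exists_continuous_density_support_subset [RegularSpace X] [LocallyCompactSpace X]
    [IsFiniteMeasureOnCompacts μ] [μ.IsOpenPosMeasure] {x : X} {U : Set X} (hU : IsOpen U)
    (hx : x ∈ U) :
    ∃ e : X → ℝ, Continuous e ∧ 0 ≤ e ∧ ∫ t, e t ∂μ = 1 ∧ Function.support e ⊆ U := by
  obtain ⟨f, hf_one, hf_zero, hf_supp, hf⟩ := exists_continuous_one_zero_of_isCompact
    (isCompact_singleton (x := x)) hU.isClosed_compl (by simpa using hx)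
  have hfx : f x ≠ 0 := by simp [hf_one (Set.mem_singleton x)]
  have hpos : 0 < ∫ t, f t ∂μ := f.continuous.integral_pos_of_hasCompactSupport_nonneg_nonzero
    hf_supp (fun t => (hf t).1) hfx
  refine ⟨fun t => (∫ s, f s ∂μ)⁻¹ * f t, by fun_prop,
    fun t => mul_nonneg (inv_nonneg.2 hpos.le) (hf t).1, ?_, fun t ht => ?_⟩
  · rw [integral_const_mul, inv_mul_cancel₀ hpos.ne']
  · by_contra htU
    exact right_ne_zero_of_mul ht (hf_zero htU)

end Density

section FiniteMeasure

variable {Ω : Type*} [MeasurableSpace Ω] {μ : Measure Ω} {q : ℝ≥0∞}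

lemma eLpNorm_one_le_max_mul_eLpNorm {g : Ω → ℝ} (hg : AEStronglyMeasurable g μ) (hq : 1 ≤ q) :
    eLpNorm g 1 μ ≤ max 1 (μ Set.univ) * eLpNorm g q μ := by
  have hexp_nonneg : 0 ≤ 1 / (1 : ℝ≥0∞).toReal - 1 / q.toReal := by
    obtain rfl | hqt := eq_or_ne q ∞
    · simp
    · have : 1 ≤ q.toReal := by simpa using ENNReal.toReal_mono hqt hq
      simpa using inv_le_one_of_one_le₀ this
  calc eLpNorm g 1 μ
      ≤ eLpNorm g q μ * μ Set.univ ^ (1 / (1 : ℝ≥0∞).toReal - 1 / q.toReal) :=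
        eLpNorm_le_eLpNorm_mul_rpow_measure_univ hq hg
    _ ≤ eLpNorm g q μ * max 1 (μ Set.univ) ^ (1 / (1 : ℝ≥0∞).toReal - 1 / q.toReal) := by
        gcongr
        exact le_max_right _ _
    _ ≤ eLpNorm g q μ * max 1 (μ Set.univ) ^ (1 : ℝ) := by
        gcongr
        · exact le_max_left _ _
        · simp
    _ = max 1 (μ Set.univ) * eLpNorm g q μ := by rw [ENNReal.rpow_one, mul_comm]

lemma tendsto_eLpNorm_sub_of_tendstoUniformly [IsFiniteMeasure μ] {ι : Type*} {l : Filter ι}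
    {F : ι → Ω → ℝ} {f : Ω → ℝ} (h : TendstoUniformly F f l) :
    Tendsto (fun i => eLpNorm (F i - f) q μ) l (𝓝 0) := by
  have hμ : μ Set.univ ^ q.toReal⁻¹ ≠ ∞ :=
    ENNReal.rpow_ne_top_of_nonneg (by positivity) (measure_ne_top _ _)
  have hbound : Tendsto (fun c : ℝ => μ Set.univ ^ q.toReal⁻¹ * ENNReal.ofReal c) (𝓝[>] 0)
      (𝓝 0) := by
    simpa using (ENNReal.Tendsto.const_mul
      (ENNReal.tendsto_ofReal (tendsto_id (x := 𝓝 (0 : ℝ)))) (.inr hμ)).mono_left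
        nhdsWithin_le_nhds
  refine ENNReal.tendsto_nhds_zero.2 fun δ hδ => ?_
  obtain ⟨c, hcδ, hc⟩ := ((hbound.eventually_lt_const hδ).and self_mem_nhdsWithin).exists
  filter_upwards [Metric.tendstoUniformly_iff.1 h c hc] with i hi
  refine (eLpNorm_le_of_ae_bound (ae_of_all _ fun x => ?_)).trans hcδ.le
  rw [Pi.sub_apply, ← dist_eq_norm, dist_comm]
  exact (hi x).le

end FiniteMeasure

section Series

lemma tendsto_ennreal_tsum_zero_of_dominated {ι κ : Type*} {l : Filter ι} {f : ι → κ → ℝ≥0∞}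
    {b : κ → ℝ≥0∞} (hb : ∑' k, b k ≠ ∞) (hfb : ∀ i k, f i k ≤ b k)
    (hf : ∀ k, Tendsto (fun i => f i k) l (𝓝 0)) :
    Tendsto (fun i => ∑' k, f i k) l (𝓝 0) := by
  have hb_top (k : κ) : b k ≠ ∞ := ENNReal.ne_top_of_tsum_ne_top hb k
  have hf_top (i : ι) (k : κ) : f i k ≠ ∞ := ne_top_of_le_ne_top (hb_top k) (hfb i k)
  have hsum_top (i : ι) : ∑' k, f i k ≠ ∞ :=
    ne_top_of_le_ne_top hb (ENNReal.tsum_le_tsum (hfb i))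
  rw [← ENNReal.tendsto_toReal_iff hsum_top ENNReal.zero_ne_top]
  simp only [ENNReal.tsum_toReal_eq (hf_top _), ENNReal.toReal_zero]
  rw [← tsum_zero (β := κ)]
  refine tendsto_tsum_of_dominated_convergence (ENNReal.summable_toReal hb)
    (fun k => (ENNReal.tendsto_toReal ENNReal.zero_ne_top).comp (hf k))
    (.of_forall fun i k => ?_)
  rw [Real.norm_of_nonneg ENNReal.toReal_nonneg]
  exact ENNReal.toReal_mono (hb_top k) (hfb i k)

lemma eLpNorm_one_le_tsum_of_hasSum {Ω ι : Type*} [Countable ι] [MeasurableSpace Ω]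
    {μ : Measure Ω} {u : ι → Ω → ℝ} {g : Ω → ℝ} (hu : ∀ k, AEStronglyMeasurable (u k) μ)
    (hsum : ∀ᵐ x ∂μ, HasSum (fun k => u k x) (g x)) :
    eLpNorm g 1 μ ≤ ∑' k, eLpNorm (u k) 1 μ := by
  simp only [eLpNorm_one_eq_lintegral_enorm]
  rw [← lintegral_tsum fun k => (hu k).enorm]
  refine lintegral_mono_ae ?_
  filter_upwards [hsum] with x hx
  exact hx.tsum_eq ▸ enorm_tsum_le_tsum_enorm

end Series

section Convolution

variable {G : Type*} [AddCommGroup G] [TopologicalSpace G] [IsTopologicalAddGroup G]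
  [MeasurableSpace G] [BorelSpace G]

lemma compactSpace_of_isFiniteMeasure [WeaklyLocallyCompactSpace G] (μ : Measure G)
    [μ.IsOpenPosMeasure] [μ.IsAddLeftInvariant] [IsFiniteMeasure μ] : CompactSpace G := by
  by_contra hG
  rw [not_compactSpace_iff] at hG
  exact measure_ne_top μ Set.univ (measure_univ_of_isAddLeftInvariant μ)

variable {μ : Measure G} [μ.IsAddLeftInvariant] {e u : G → ℝ} {q : ℝ≥0∞}

section Tonelli

variable [CompactSpace G] [IsFiniteMeasure μ]

-- The integrand need not be measurable for the product `σ`-algebra, as `G` need not be second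
-- countable; hence Fubini's theorem is used in its version for continuous functions.
lemma lintegral_lintegral_enorm_sub (he : Continuous e) (ν : Measure G) [IsFiniteMeasure ν] :
    ∫⁻ x, ∫⁻ t, ‖e (x - t)‖ₑ ∂ν ∂μ = eLpNorm e 1 μ * ν Set.univ := by
  have hcont : Continuous (Function.uncurry fun x t : G => ‖e (x - t)‖) := by
    simp only [Function.uncurry_def]
    fun_prop
  have hinner : Continuous fun x => ∫ t, ‖e (x - t)‖ ∂ν := by
    rw [← continuousOn_univ]
    exact continuousOn_integral_of_compact_support isCompact_univ hcont.continuousOn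
      fun _ t _ ht => absurd (Set.mem_univ t) ht
  calc ∫⁻ x, ∫⁻ t, ‖e (x - t)‖ₑ ∂ν ∂μ
      = ∫⁻ x, ENNReal.ofReal (∫ t, ‖e (x - t)‖ ∂ν) ∂μ := by
        refine lintegral_congr fun x => (ofReal_integral_norm_eq_lintegral_enorm ?_).symm
        exact integrable_of_continuous (by fun_prop)
    _ = ENNReal.ofReal (∫ x, ∫ t, ‖e (x - t)‖ ∂ν ∂μ) :=
        (ofReal_integral_eq_lintegral_ofReal (integrable_of_continuous hinner)
          (ae_of_all _ fun x => integral_nonneg fun t => norm_nonneg _)).symm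
    _ = ENNReal.ofReal (∫ t, ∫ x, ‖e (x - t)‖ ∂μ ∂ν) := by
        rw [integral_integral_swap_of_hasCompactSupport hcont (.of_compactSpace _)]
    _ = ENNReal.ofReal (ν.real Set.univ * ∫ x, ‖e x‖ ∂μ) := by
        simp only [integral_sub_right_eq_self fun x => ‖e x‖, integral_const, smul_eq_mul]
    _ = eLpNorm e 1 μ * ν Set.univ := by
        rw [ENNReal.ofReal_mul measureReal_nonneg, ofReal_measureReal,
          ofReal_integral_norm_eq_lintegral_enorm (integrable_of_continuous he),
          eLpNorm_one_eq_lintegral_enorm, mul_comm]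

lemma lintegral_eLpNorm_withDensity_rpow (he : Continuous e) {q : ℝ≥0} (hq : q ≠ 0)
    (hu : MemLp u q μ) :
    ∫⁻ x, eLpNorm u q (μ.withDensity fun t => ‖e (x - t)‖ₑ) ^ (q : ℝ) ∂μ =
      eLpNorm e 1 μ * eLpNorm u q μ ^ (q : ℝ) := by
  set w : G → ℝ≥0∞ := fun t => ‖u t‖ₑ ^ (q : ℝ)
  have hw : AEMeasurable w μ := hu.1.enorm.pow_const _
  have hw_int : ∫⁻ t, w t ∂μ = eLpNorm u q μ ^ (q : ℝ) :=
    (eLpNorm_nnreal_pow_eq_lintegral hq).symm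
  have : IsFiniteMeasure (μ.withDensity w) := isFiniteMeasure_withDensity <| by
    rw [hw_int]
    exact ENNReal.rpow_ne_top_of_nonneg q.2 hu.2.ne
  have hslice (x : G) : eLpNorm u q (μ.withDensity fun t => ‖e (x - t)‖ₑ) ^ (q : ℝ) =
      ∫⁻ t, ‖e (x - t)‖ₑ ∂(μ.withDensity w) := by
    have he_meas : AEMeasurable (fun t => ‖e (x - t)‖ₑ) μ :=
      (show Continuous fun t => e (x - t) by fun_prop).measurable.enorm.aemeasurable
    rw [eLpNorm_nnreal_pow_eq_lintegral hq, lintegral_withDensity_eq_lintegral_mul₀ he_meas hw,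
      lintegral_withDensity_eq_lintegral_mul₀ hw he_meas, mul_comm]
  rw [lintegral_congr hslice, lintegral_lintegral_enorm_sub he,
    withDensity_apply _ MeasurableSet.univ, Measure.restrict_univ, hw_int]

end Tonelli

variable [μ.IsNegInvariant]

lemma groupConv_apply_eq_integral_sub (e u : G → ℝ) (x : G) :
    groupConv μ e u x = ∫ t, e (x - t) * u t ∂μ :=
  convolution_eq_swap _

lemma withDensity_enorm_sub_univ (e : G → ℝ) (x : G) :
    (μ.withDensity fun t => ‖e (x - t)‖ₑ) Set.univ = eLpNorm e 1 μ := by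
  rw [withDensity_apply _ MeasurableSet.univ, Measure.restrict_univ,
    lintegral_sub_left_eq_self (fun t => ‖e t‖ₑ) x, eLpNorm_one_eq_lintegral_enorm]

lemma enorm_groupConv_le_eLpNorm_withDensity (he : Continuous e)
    (hu : AEStronglyMeasurable u μ) (hq : 1 ≤ q) (x : G) :
    ‖groupConv μ e u x‖ₑ ≤ eLpNorm u q (μ.withDensity fun t => ‖e (x - t)‖ₑ) *
      eLpNorm e 1 μ ^ (1 - 1 / q.toReal) := by
  have he_meas : Measurable fun t => ‖e (x - t)‖ₑ :=
    (show Continuous fun t => e (x - t) by fun_prop).measurable.enorm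
  calc ‖groupConv μ e u x‖ₑ
      ≤ ∫⁻ t, ‖e (x - t)‖ₑ * ‖u t‖ₑ ∂μ := by
        rw [groupConv_apply_eq_integral_sub]
        simpa only [enorm_mul] using
          enorm_integral_le_lintegral_enorm (μ := μ) fun t => e (x - t) * u t
    _ = eLpNorm u 1 (μ.withDensity fun t => ‖e (x - t)‖ₑ) := by
        rw [eLpNorm_one_eq_lintegral_enorm,
          lintegral_withDensity_eq_lintegral_mul₀ he_meas.aemeasurable hu.enorm]
        rfl
    _ ≤ _ := by
        simpa only [ENNReal.toReal_one, one_div_one, withDensity_enorm_sub_univ] using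
          eLpNorm_le_eLpNorm_mul_rpow_measure_univ hq
            (hu.mono_ac (withDensity_absolutelyContinuous μ fun t => ‖e (x - t)‖ₑ))

lemma eLpNorm_top_groupConv_le (he : Continuous e) (hu : AEStronglyMeasurable u μ) :
    eLpNorm (groupConv μ e u) ∞ μ ≤ eLpNorm e 1 μ * eLpNorm u ∞ μ := by
  refine eLpNormEssSup_le_of_ae_enorm_bound (ae_of_all _ fun x => ?_)
  calc ‖groupConv μ e u x‖ₑ
      ≤ eLpNorm u ∞ (μ.withDensity fun t => ‖e (x - t)‖ₑ) * eLpNorm e 1 μ := by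
        simpa using enorm_groupConv_le_eLpNorm_withDensity he hu le_top x
    _ ≤ eLpNorm u ∞ μ * eLpNorm e 1 μ := by
        refine mul_le_mul_left ?_ _
        exact eLpNormEssSup_mono_measure u (withDensity_absolutelyContinuous _ _)
    _ = _ := mul_comm _ _

section Compact

variable [CompactSpace G]

lemma continuous_groupConv (he : Continuous e) (hu : Integrable u μ) :
    Continuous (groupConv μ e u) :=
  (HasCompactSupport.of_compactSpace e).continuous_convolution_left _ he hu.locallyIntegrable

lemma convolutionExists_of_continuous (he : Continuous e) (hu : Integrable u μ) :
    ConvolutionExists e u (ContinuousLinearMap.mul ℝ ℝ) μ :=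
  (HasCompactSupport.of_compactSpace e).convolutionExists_left _ he hu.locallyIntegrable

lemma groupConv_add (he : Continuous e) {v : G → ℝ} (hu : Integrable u μ)
    (hv : Integrable v μ) : groupConv μ e (u + v) = groupConv μ e u + groupConv μ e v :=
  (convolutionExists_of_continuous he hu).distrib_add (convolutionExists_of_continuous he hv)

lemma hasSum_groupConv {ι : Type*} [Countable ι] {v : ι → G → ℝ} (he : Continuous e)
    (hv : ∀ k, AEStronglyMeasurable (v k) μ) (hv_sum : ∑' k, eLpNorm (v k) 1 μ ≠ ∞)
    (hs : ∀ᵐ x ∂μ, HasSum (fun k => v k x) (u x)) (x : G) :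
    HasSum (fun k => groupConv μ e (v k) x) (groupConv μ e u x) := by
  obtain ⟨C, hC⟩ := isCompact_univ.exists_bound_of_continuousOn he.continuousOn
  have hv_int (k : ι) : Integrable (v k) μ :=
    memLp_one_iff_integrable.1 ⟨hv k, (ENNReal.ne_top_of_tsum_ne_top hv_sum k).lt_top⟩
  have hint (k : ι) : Integrable (fun t => e t * v k (x - t)) μ :=
    convolutionExists_of_continuous he (hv_int k) x
  have hnorm (k : ι) : ∫ t, ‖e t * v k (x - t)‖ ∂μ ≤ C * (eLpNorm (v k) 1 μ).toReal :=
    calc ∫ t, ‖e t * v k (x - t)‖ ∂μ ≤ ∫ t, C * ‖v k (x - t)‖ ∂μ := by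
          refine integral_mono (hint k).norm (((hv_int k).comp_sub_left x).norm.const_mul C)
            fun t => ?_
          simp only [norm_mul]
          gcongr
          exact hC t (Set.mem_univ t)
      _ = C * (eLpNorm (v k) 1 μ).toReal := by
          rw [integral_const_mul, integral_sub_left_eq_self (fun t => ‖v k t‖),
            integral_norm_eq_lintegral_enorm (hv k), eLpNorm_one_eq_lintegral_enorm]
  have hsummable : Summable fun k => ∫ t, ‖e t * v k (x - t)‖ ∂μ :=
    ((ENNReal.summable_toReal hv_sum).mul_left C).of_nonneg_of_le
      (fun k => integral_nonneg fun t => norm_nonneg _) hnorm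
  have hlim : groupConv μ e u x = ∫ t, ∑' k, e t * v k (x - t) ∂μ := by
    refine integral_congr_ae ?_
    filter_upwards [(Measure.measurePreserving_sub_left μ x).quasiMeasurePreserving.ae hs] with t ht
    exact (ht.mul_left (e t)).tsum_eq.symm
  rw [hlim]
  exact hasSum_integral_of_summable_integral_norm hint hsummable

variable [IsFiniteMeasure μ]

theorem eLpNorm_groupConv_le (he : Continuous e) (hq : 1 ≤ q) (hu : MemLp u q μ) :
    eLpNorm (groupConv μ e u) q μ ≤ eLpNorm e 1 μ * eLpNorm u q μ := by
  induction q with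
  | top => exact eLpNorm_top_groupConv_le he hu.1
  | coe q =>
    have hq_one : (1 : ℝ) ≤ q := by exact_mod_cast hq
    have hq_pos : (0 : ℝ) < q := zero_lt_one.trans_le hq_one
    have hq_ne : q ≠ 0 := by exact_mod_cast hq_pos.ne'
    set A := eLpNorm e 1 μ
    have hA : A ≠ ∞ := (memLp_one_iff_integrable.2 (integrable_of_continuous he)).2.ne
    have hexp : (1 - 1 / (q : ℝ)) * q = q - 1 := by field_simp
    rw [← ENNReal.rpow_le_rpow_iff hq_pos, eLpNorm_nnreal_pow_eq_lintegral hq_ne]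
    calc ∫⁻ x, ‖groupConv μ e u x‖ₑ ^ (q : ℝ) ∂μ
        ≤ ∫⁻ x, eLpNorm u q (μ.withDensity fun t => ‖e (x - t)‖ₑ) ^ (q : ℝ) *
            A ^ ((q : ℝ) - 1) ∂μ := by
          refine lintegral_mono fun x => ?_
          rw [← hexp, ENNReal.rpow_mul, ← ENNReal.mul_rpow_of_nonneg _ _ hq_pos.le]
          gcongr
          exact enorm_groupConv_le_eLpNorm_withDensity he hu.1 hq x
      _ = A * eLpNorm u q μ ^ (q : ℝ) * A ^ ((q : ℝ) - 1) := by
          rw [lintegral_mul_const' _ _ (ENNReal.rpow_ne_top_of_nonneg (by linarith) hA),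
            lintegral_eLpNorm_withDensity_rpow he hq_ne hu]
      _ = A ^ (1 + ((q : ℝ) - 1)) * eLpNorm u q μ ^ (q : ℝ) := by
          rw [ENNReal.rpow_add_of_nonneg _ _ zero_le_one (by linarith), ENNReal.rpow_one]
          ring
      _ = (A * eLpNorm u q μ) ^ (q : ℝ) := by
          rw [add_sub_cancel, ENNReal.mul_rpow_of_nonneg _ _ hq_pos.le]

lemma eLpNorm_groupConv_sub_self_le (he : Continuous e) (hq : 1 ≤ q) (hu : Integrable u μ) :
    eLpNorm (groupConv μ e u - u) q μ ≤ (eLpNorm e 1 μ + 1) * eLpNorm u q μ := by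
  obtain hu_top | hu_top := eq_or_ne (eLpNorm u q μ) ∞
  · simp [hu_top]
  calc eLpNorm (groupConv μ e u - u) q μ
      ≤ eLpNorm (groupConv μ e u) q μ + eLpNorm u q μ :=
        eLpNorm_sub_le (continuous_groupConv he hu).aestronglyMeasurable hu.1 hq
    _ ≤ eLpNorm e 1 μ * eLpNorm u q μ + eLpNorm u q μ := by
        gcongr
        exact eLpNorm_groupConv_le he hq ⟨hu.1, hu_top.lt_top⟩
    _ = (eLpNorm e 1 μ + 1) * eLpNorm u q μ := by rw [add_mul, one_mul]

end Compact

end Convolution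

/-- A Dirac net along the filter `l`: continuous probability densities `e i` with respect to `μ`
whose supports shrink to `0`. Continuity is required because it makes convolutions with `e i`
measurable on groups that are not second countable. -/
structure IsDiracNet {G ι : Type*} [Zero G] [TopologicalSpace G] [MeasurableSpace G]
    (μ : Measure G) (l : Filter ι) (e : ι → G → ℝ) : Prop where
  continuous : ∀ i, Continuous (e i)
  nonneg : ∀ i, 0 ≤ e i
  integral_eq_one : ∀ i, ∫ t, e i t ∂μ = 1
  tendsto_support : Tendsto (fun i => Function.support (e i)) l (𝓝 0).smallSets

section DiracNet

lemma exists_isDiracNet_openNhdsOf {G : Type*} [Zero G] [TopologicalSpace G] [RegularSpace G]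
    [LocallyCompactSpace G] [MeasurableSpace G] [BorelSpace G] (μ : Measure G)
    [IsFiniteMeasureOnCompacts μ] [μ.IsOpenPosMeasure] :
    ∃ e : (TopologicalSpace.OpenNhdsOf (0 : G))ᵒᵈ → G → ℝ, IsDiracNet μ atTop e := by
  choose e he_cont he_nonneg he_int he_supp using
    fun U : (TopologicalSpace.OpenNhdsOf (0 : G))ᵒᵈ =>
      exists_continuous_density_support_subset (μ := μ) (OrderDual.ofDual U).isOpen
        (OrderDual.ofDual U).mem
  refine ⟨e, he_cont, he_nonneg, he_int, ?_⟩
  refine TopologicalSpace.OpenNhdsOf.basis_nhds.smallSets.tendsto_right_iff.2 fun U _ => ?_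
  filter_upwards [eventually_ge_atTop (OrderDual.toDual U)] with V hV
  exact (he_supp V).trans hV

variable {G ι : Type*} {l : Filter ι} {e : ι → G → ℝ}

lemma IsDiracNet.eLpNorm_one [Zero G] [TopologicalSpace G] [MeasurableSpace G] {μ : Measure G}
    (he : IsDiracNet μ l e) (i : ι) : eLpNorm (e i) 1 μ = 1 := by
  have hint : Integrable (e i) μ := .of_integral_ne_zero (by simp [he.integral_eq_one i])
  rw [eLpNorm_one_eq_lintegral_enorm, ← ofReal_integral_norm_eq_lintegral_enorm hint]
  simp only [Real.norm_of_nonneg (he.nonneg i _), he.integral_eq_one i, ENNReal.ofReal_one]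

variable [AddCommGroup G] [TopologicalSpace G] [IsTopologicalAddGroup G] [MeasurableSpace G]
  [BorelSpace G] [CompactSpace G] {μ : Measure G} [IsFiniteMeasure μ]

lemma dist_groupConv_le {d φ : G → ℝ} (hd : Continuous d) (hd_nonneg : 0 ≤ d)
    (hd_int : ∫ t, d t ∂μ = 1) (hφ : Continuous φ) {x : G} {c : ℝ}
    (h : ∀ t ∈ Function.support d, dist (φ (x - t)) (φ x) ≤ c) :
    dist (groupConv μ d φ x) (φ x) ≤ c := by
  have hdiff : groupConv μ d φ x - φ x = ∫ t, d t * (φ (x - t) - φ x) ∂μ := by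
    simp only [mul_sub]
    rw [integral_sub (integrable_of_continuous (by fun_prop))
      (integrable_of_continuous (by fun_prop)), integral_mul_const, hd_int, one_mul]
    rfl
  calc dist (groupConv μ d φ x) (φ x) = ‖∫ t, d t * (φ (x - t) - φ x) ∂μ‖ := by
        rw [dist_eq_norm, hdiff]
    _ ≤ ∫ t, d t * c ∂μ := by
        refine norm_integral_le_of_norm_le (integrable_of_continuous (by fun_prop))
          (ae_of_all _ fun t => ?_)
        rw [norm_mul, Real.norm_of_nonneg (hd_nonneg t), ← dist_eq_norm]
        obtain ht | ht := eq_or_ne (d t) 0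
        · simp [ht]
        · exact mul_le_mul_of_nonneg_left (h t ht) (hd_nonneg t)
    _ = c := by rw [integral_mul_const, hd_int, one_mul]

namespace IsDiracNet

lemma tendstoUniformly_groupConv (he : IsDiracNet μ l e) {φ : G → ℝ} (hφ : Continuous φ) :
    TendstoUniformly (fun i => groupConv μ (e i) φ) φ l := by
  refine Metric.tendstoUniformly_iff.2 fun c hc => ?_
  have hnear : ∀ᶠ t in 𝓝 (0 : G), ∀ x ∈ (Set.univ : Set G),
      dist (φ (x - t)) (φ x) ≤ c / 2 := by
    refine isCompact_univ.eventually_forall_of_forall_eventually fun x _ => ?_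
    have hcont : Continuous fun z : G × G => dist (φ (z.2 - z.1)) (φ z.2) := by fun_prop
    exact (hcont.tendsto (0, x)).eventually_le_const (by simpa using hc)
  filter_upwards [tendsto_smallSets_iff.1 he.tendsto_support _ hnear] with i hi x
  rw [dist_comm]
  exact (dist_groupConv_le (he.continuous i) (he.nonneg i) (he.integral_eq_one i) hφ
    fun t ht => hi ht x (Set.mem_univ x)).trans_lt (half_lt_self hc)

variable [μ.IsAddLeftInvariant] [μ.IsNegInvariant] {u : G → ℝ} {q : ℝ≥0∞}

lemma eLpNorm_groupConv_sub_self_le (he : IsDiracNet μ l e) (i : ι) (hq : 1 ≤ q)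
    (hu : Integrable u μ) :
    eLpNorm (groupConv μ (e i) u - u) q μ ≤ 2 * eLpNorm u q μ := by
  simpa only [he.eLpNorm_one i, one_add_one_eq_two] using
    _root_.eLpNorm_groupConv_sub_self_le (he.continuous i) hq hu

theorem tendsto_eLpNorm_groupConv_sub_self [μ.WeaklyRegular] (he : IsDiracNet μ l e)
    (hq : 1 ≤ q) (hq_top : q ≠ ∞) (hu : MemLp u q μ) :
    Tendsto (fun i => eLpNorm (groupConv μ (e i) u - u) q μ) l (𝓝 0) := by
  refine ENNReal.tendsto_nhds_zero.2 fun δ hδ => ?_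
  have hδ' : δ / 3 ≠ 0 := by simp [hδ.ne']
  obtain ⟨φ, hφ_cont, hφ, hφ_mem⟩ : ∃ φ : G → ℝ, Continuous φ ∧
      eLpNorm (u - φ) q μ ≤ δ / 3 ∧ MemLp φ q μ := by
    obtain ⟨φ, hφ, hφ_mem⟩ := hu.exists_boundedContinuous_eLpNorm_sub_le hq_top hδ'
    exact ⟨φ, φ.continuous, hφ, hφ_mem⟩
  have hφ_int : Integrable φ μ := hφ_mem.integrable hq
  have hdiff_int : Integrable (u - φ) μ := (hu.sub hφ_mem).integrable hq
  have hconv := tendsto_eLpNorm_sub_of_tendstoUniformly (μ := μ) (q := q)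
    (he.tendstoUniformly_groupConv hφ_cont)
  filter_upwards [ENNReal.tendsto_nhds_zero.1 hconv (δ / 3) (pos_iff_ne_zero.2 hδ')] with i hi
  have hsplit : groupConv μ (e i) u - u =
      (groupConv μ (e i) (u - φ) - (u - φ)) + (groupConv μ (e i) φ - φ) := by
    nth_rw 1 [← sub_add_cancel u φ]
    rw [groupConv_add (he.continuous i) hdiff_int hφ_int]
    abel
  have hmeas {v : G → ℝ} (hv : Integrable v μ) :
      AEStronglyMeasurable (groupConv μ (e i) v - v) μ :=
    (continuous_groupConv (he.continuous i) hv).aestronglyMeasurable.sub hv.1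
  calc eLpNorm (groupConv μ (e i) u - u) q μ
      ≤ eLpNorm (groupConv μ (e i) (u - φ) - (u - φ)) q μ +
          eLpNorm (groupConv μ (e i) φ - φ) q μ := by
        rw [hsplit]
        exact eLpNorm_add_le (hmeas hdiff_int) (hmeas hφ_int) hq
    _ ≤ 2 * (δ / 3) + δ / 3 := by
        gcongr
        exact (he.eLpNorm_groupConv_sub_self_le i hq hdiff_int).trans (by gcongr)
    _ = δ := by rw [two_mul, ENNReal.add_thirds]

end IsDiracNet

end DiracNet

section SmallLebesgue

variable {Ω : Type*} [MeasurableSpace Ω] {μ : Measure Ω} {p θ ε : ℝ} {g : Ω → ℝ}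

lemma one_le_conjExponent (q : ℝ≥0∞) : 1 ≤ ENNReal.conjExponent q := le_self_add

lemma ofReal_rpow_ne_zero (hε : 0 < ε) (a : ℝ) : ENNReal.ofReal (ε ^ a) ≠ 0 := by
  simpa using Real.rpow_pos_of_pos hε a

lemma smallLebesgueGauge_le (hε : ε ∈ Set.Ioc 0 (p - 1)) :
    smallLebesgueGauge p θ μ g ≤ ENNReal.ofReal (ε ^ (-θ / (p - ε))) *
      eLpNorm g (ENNReal.conjExponent (ENNReal.ofReal (p - ε))) μ :=
  iInf₂_le ε hε

lemma le_mul_smallLebesgueGauge {a c : ℝ≥0∞} (hc : c ≠ 0) (hc_top : c ≠ ∞)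
    (h : ∀ ε ∈ Set.Ioc 0 (p - 1), a ≤ c * (ENNReal.ofReal (ε ^ (-θ / (p - ε))) *
      eLpNorm g (ENNReal.conjExponent (ENNReal.ofReal (p - ε))) μ)) :
    a ≤ c * smallLebesgueGauge p θ μ g :=
  (ENNReal.inv_mul_le_iff hc hc_top).1 <|
    le_iInf₂ fun ε hε => (ENNReal.inv_mul_le_iff hc hc_top).2 (h ε hε)

lemma smallLebesgueGauge_le_mul_of_eLpNorm_le {v : Ω → ℝ} {c : ℝ≥0∞} (hc : c ≠ 0)
    (hc_top : c ≠ ∞) (h : ∀ q, 1 ≤ q → eLpNorm v q μ ≤ c * eLpNorm g q μ) :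
    smallLebesgueGauge p θ μ v ≤ c * smallLebesgueGauge p θ μ g := by
  refine le_mul_smallLebesgueGauge hc hc_top fun ε hε => (smallLebesgueGauge_le hε).trans ?_
  rw [mul_left_comm]
  gcongr
  exact h _ (one_le_conjExponent _)

lemma smallLebesgueGauge_le_eLpNorm_top (hp : 1 < p) :
    smallLebesgueGauge p θ μ g ≤ ENNReal.ofReal ((p - 1) ^ (-θ)) * eLpNorm g ∞ μ := by
  simpa [ENNReal.conjExponent] using
    smallLebesgueGauge_le (θ := θ) (μ := μ) (g := g) (Set.right_mem_Ioc.2 (sub_pos.2 hp))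

lemma smallLebesgueGauge_zero (hp : 1 < p) : smallLebesgueGauge p θ μ 0 = 0 :=
  le_zero_iff.1 ((smallLebesgueGauge_le_eLpNorm_top hp).trans_eq (by simp))

lemma rpow_neg_le_rpow_neg_div_sub (hθ : 0 ≤ θ) (hε : ε ∈ Set.Ioc 0 (p - 1)) :
    p ^ (-θ) ≤ ε ^ (-θ / (p - ε)) := by
  obtain ⟨hε_pos, hε_le⟩ := hε
  have hden : 1 ≤ p - ε := by linarith
  have hexp_le : θ / (p - ε) ≤ θ := div_le_self hθ hden
  have hexp_nonneg : 0 ≤ θ / (p - ε) := div_nonneg hθ (by linarith)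
  rw [neg_div]
  calc p ^ (-θ) ≤ p ^ (-(θ / (p - ε))) :=
        Real.rpow_le_rpow_of_exponent_le (by linarith) (by linarith)
    _ ≤ ε ^ (-(θ / (p - ε))) := Real.rpow_le_rpow_of_nonpos hε_pos (by linarith) (by linarith)

lemma eLpNorm_one_le_smallLebesgueGauge [IsFiniteMeasure μ] (hp : 1 < p) (hθ : 0 ≤ θ)
    (hg : AEStronglyMeasurable g μ) :
    eLpNorm g 1 μ ≤
      ENNReal.ofReal (p ^ θ) * max 1 (μ Set.univ) * smallLebesgueGauge p θ μ g := by
  have hp_pos : 0 < p := zero_lt_one.trans hp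
  have hM : max 1 (μ Set.univ) ≠ 0 := (zero_lt_one.trans_le (le_max_left _ _)).ne'
  have hM_top : max 1 (μ Set.univ) ≠ ∞ := by simp
  refine le_mul_smallLebesgueGauge (mul_ne_zero (ofReal_rpow_ne_zero hp_pos θ) hM)
    (ENNReal.mul_ne_top ENNReal.ofReal_ne_top hM_top) fun ε hε => ?_
  have hweight : 1 ≤ ENNReal.ofReal (p ^ θ) * ENNReal.ofReal (ε ^ (-θ / (p - ε))) := by
    rw [← ENNReal.ofReal_mul (by positivity), ENNReal.one_le_ofReal]
    calc 1 = p ^ θ * p ^ (-θ) := by rw [← Real.rpow_add hp_pos, add_neg_cancel, Real.rpow_zero]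
      _ ≤ p ^ θ * ε ^ (-θ / (p - ε)) := by
        gcongr
        exact rpow_neg_le_rpow_neg_div_sub hθ hε
  set N := eLpNorm g (ENNReal.conjExponent (ENNReal.ofReal (p - ε))) μ
  calc eLpNorm g 1 μ ≤ max 1 (μ Set.univ) * N :=
        eLpNorm_one_le_max_mul_eLpNorm hg (one_le_conjExponent _)
    _ ≤ ENNReal.ofReal (p ^ θ) * ENNReal.ofReal (ε ^ (-θ / (p - ε))) *
          (max 1 (μ Set.univ) * N) := le_mul_of_one_le_left' hweight
    _ = _ := by ring

-- At `ε = p - 1` the exponent is `∞`; as `μ` is finite, `ε` may be replaced by `ε / 2`.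
lemma exists_memLp_of_smallLebesgueGauge_ne_top [IsFiniteMeasure μ]
    (hg : AEStronglyMeasurable g μ) (hg_top : smallLebesgueGauge p θ μ g ≠ ∞) :
    ∃ ε ∈ Set.Ioc 0 (p - 1), ENNReal.conjExponent (ENNReal.ofReal (p - ε)) ≠ ∞ ∧
      MemLp g (ENNReal.conjExponent (ENNReal.ofReal (p - ε))) μ := by
  obtain ⟨ε, hε, hlt⟩ : ∃ ε ∈ Set.Ioc 0 (p - 1), ENNReal.ofReal (ε ^ (-θ / (p - ε))) *
      eLpNorm g (ENNReal.conjExponent (ENNReal.ofReal (p - ε))) μ < ∞ := by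
    simpa only [smallLebesgueGauge, iInf_lt_iff, exists_prop] using hg_top.lt_top
  have hmem : MemLp g (ENNReal.conjExponent (ENNReal.ofReal (p - ε))) μ :=
    ⟨hg, ENNReal.lt_top_of_mul_ne_top_right hlt.ne (ofReal_rpow_ne_zero hε.1 _)⟩
  obtain ⟨hε_pos, hε_le⟩ := hε
  have hhalf : ε / 2 < ε := half_lt_self hε_pos
  refine ⟨ε / 2, ⟨half_pos hε_pos, hhalf.le.trans hε_le⟩, ?_, hmem.mono_exponent ?_⟩
  · have hlt_one : 1 < ENNReal.ofReal (p - ε / 2) := ENNReal.one_lt_ofReal.2 (by linarith)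
    exact ENNReal.add_ne_top.2
      ⟨ENNReal.one_ne_top, ENNReal.inv_ne_top.2 (tsub_pos_of_lt hlt_one).ne'⟩
  · unfold ENNReal.conjExponent
    gcongr

lemma smallLebesgueNorm_le_tsum {u : ℕ → Ω → ℝ} (hu : ∀ k, AEStronglyMeasurable (u k) μ)
    (hsum : ∀ᵐ x ∂μ, HasSum (fun k => u k x) (g x)) :
    smallLebesgueNorm p θ μ g ≤ ∑' k, smallLebesgueGauge p θ μ (u k) :=
  iInf_le_of_le u (iInf₂_le hu hsum)

lemma smallLebesgueNorm_le_smallLebesgueGauge (hp : 1 < p) (hg : AEStronglyMeasurable g μ) :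
    smallLebesgueNorm p θ μ g ≤ smallLebesgueGauge p θ μ g := by
  have hu (k : ℕ) : AEStronglyMeasurable ((Pi.single 0 g : ℕ → Ω → ℝ) k) μ := by
    obtain rfl | hk := eq_or_ne k 0
    · simpa using hg
    · simpa [hk] using aestronglyMeasurable_zero
  have hsum (x : Ω) : HasSum (fun k => (Pi.single 0 g : ℕ → Ω → ℝ) k x) (g x) :=
    Pi.hasSum.1 (hasSum_pi_single 0 g) x
  refine (smallLebesgueNorm_le_tsum hu (ae_of_all _ hsum)).trans_eq ?_
  rw [tsum_eq_single 0 fun k hk => by rw [Pi.single_eq_of_ne hk, smallLebesgueGauge_zero hp],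
    Pi.single_eq_same]

lemma memSmallLebesgue_of_memLp_top (hp : 1 < p) (hg : MemLp g ∞ μ) :
    MemSmallLebesgue p θ μ g :=
  ⟨hg.1, (smallLebesgueNorm_le_smallLebesgueGauge hp hg.1).trans_lt <|
    (smallLebesgueGauge_le_eLpNorm_top hp).trans_lt <|
      ENNReal.mul_lt_top ENNReal.ofReal_lt_top hg.2⟩

lemma memSmallLebesgue_of_continuous [TopologicalSpace Ω] [CompactSpace Ω] [BorelSpace Ω]
    (hp : 1 < p) (hg : Continuous g) : MemSmallLebesgue p θ μ g :=
  memSmallLebesgue_of_memLp_top hp (hg.memLp_top_of_hasCompactSupport (.of_compactSpace g) μ)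

lemma tsum_eLpNorm_one_le_tsum_smallLebesgueGauge [IsFiniteMeasure μ] (hp : 1 < p) (hθ : 0 ≤ θ)
    {ι : Type*} {u : ι → Ω → ℝ} (hu : ∀ k, AEStronglyMeasurable (u k) μ) :
    ∑' k, eLpNorm (u k) 1 μ ≤
      ENNReal.ofReal (p ^ θ) * max 1 (μ Set.univ) * ∑' k, smallLebesgueGauge p θ μ (u k) := by
  rw [← ENNReal.tsum_mul_left]
  exact ENNReal.tsum_le_tsum fun k => eLpNorm_one_le_smallLebesgueGauge hp hθ (hu k)

namespace MemSmallLebesgue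

lemma exists_hasSum (hg : MemSmallLebesgue p θ μ g) :
    ∃ u : ℕ → Ω → ℝ, (∀ k, AEStronglyMeasurable (u k) μ) ∧
      (∀ᵐ x ∂μ, HasSum (fun k => u k x) (g x)) ∧
      ∑' k, smallLebesgueGauge p θ μ (u k) ≠ ∞ := by
  simpa only [smallLebesgueNorm, iInf_lt_iff, exists_prop, ← lt_top_iff_ne_top] using hg.2

lemma exists_hasSum_eLpNorm_one [IsFiniteMeasure μ] (hp : 1 < p) (hθ : 0 ≤ θ)
    (hg : MemSmallLebesgue p θ μ g) :
    ∃ u : ℕ → Ω → ℝ, (∀ k, AEStronglyMeasurable (u k) μ) ∧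
      (∀ᵐ x ∂μ, HasSum (fun k => u k x) (g x)) ∧
      ∑' k, smallLebesgueGauge p θ μ (u k) ≠ ∞ ∧ ∑' k, eLpNorm (u k) 1 μ ≠ ∞ := by
  obtain ⟨u, hu, hsum, hgauge⟩ := hg.exists_hasSum
  have hK : ENNReal.ofReal (p ^ θ) * max 1 (μ Set.univ) ≠ ∞ := by
    finiteness
  exact ⟨u, hu, hsum, hgauge, ne_top_of_le_ne_top (ENNReal.mul_ne_top hK hgauge)
    (tsum_eLpNorm_one_le_tsum_smallLebesgueGauge hp hθ hu)⟩

lemma integrable [IsFiniteMeasure μ] (hp : 1 < p) (hθ : 0 ≤ θ)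
    (hg : MemSmallLebesgue p θ μ g) : Integrable g μ := by
  obtain ⟨u, hu, hsum, -, hL1⟩ := hg.exists_hasSum_eLpNorm_one hp hθ
  exact memLp_one_iff_integrable.1
    ⟨hg.1, (eLpNorm_one_le_tsum_of_hasSum hu hsum).trans_lt hL1.lt_top⟩

end MemSmallLebesgue

end SmallLebesgue

namespace IsDiracNet

variable {G ι : Type*} [AddCommGroup G] [TopologicalSpace G] [IsTopologicalAddGroup G]
  [MeasurableSpace G] [BorelSpace G] [CompactSpace G] {μ : Measure G} [IsFiniteMeasure μ]
  [μ.IsAddLeftInvariant] [μ.IsNegInvariant] {l : Filter ι} {e : ι → G → ℝ} {p θ : ℝ}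

lemma smallLebesgueGauge_groupConv_sub_self_le (he : IsDiracNet μ l e) (i : ι) {u : G → ℝ}
    (hu : Integrable u μ) :
    smallLebesgueGauge p θ μ (groupConv μ (e i) u - u) ≤ 2 * smallLebesgueGauge p θ μ u :=
  smallLebesgueGauge_le_mul_of_eLpNorm_le two_ne_zero ENNReal.ofNat_ne_top
    fun _ hq => he.eLpNorm_groupConv_sub_self_le i hq hu

variable [μ.WeaklyRegular]

lemma tendsto_smallLebesgueGauge_groupConv_sub_self (he : IsDiracNet μ l e) {u : G → ℝ}
    (hu : AEStronglyMeasurable u μ) (hu_top : smallLebesgueGauge p θ μ u ≠ ∞) :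
    Tendsto (fun i => smallLebesgueGauge p θ μ (groupConv μ (e i) u - u)) l (𝓝 0) := by
  obtain ⟨ε, hε, hq_top, hmem⟩ := exists_memLp_of_smallLebesgueGauge_ne_top hu hu_top
  have hconv := ENNReal.Tendsto.const_mul
    (he.tendsto_eLpNorm_groupConv_sub_self (one_le_conjExponent _) hq_top hmem)
    (.inr (ENNReal.ofReal_ne_top (r := ε ^ (-θ / (p - ε)))))
  rw [mul_zero] at hconv
  exact tendsto_of_tendsto_of_tendsto_of_le_of_le tendsto_const_nhds hconv (fun _ => zero_le)
    fun _ => smallLebesgueGauge_le hε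

theorem tendsto_smallLebesgueNorm_groupConv_sub_self (he : IsDiracNet μ l e) (hp : 1 < p)
    (hθ : 0 ≤ θ) {f : G → ℝ} (hf : MemSmallLebesgue p θ μ f) :
    Tendsto (fun i => smallLebesgueNorm p θ μ (groupConv μ (e i) f - f)) l (𝓝 0) := by
  obtain ⟨u, hu, hsum, hgauge, hL1⟩ := hf.exists_hasSum_eLpNorm_one hp hθ
  have hu_int (k : ℕ) : Integrable (u k) μ :=
    memLp_one_iff_integrable.1 ⟨hu k, (ENNReal.ne_top_of_tsum_ne_top hL1 k).lt_top⟩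
  have hle (i : ι) : smallLebesgueNorm p θ μ (groupConv μ (e i) f - f) ≤
      ∑' k, smallLebesgueGauge p θ μ (groupConv μ (e i) (u k) - u k) := by
    refine smallLebesgueNorm_le_tsum (fun k =>
      (continuous_groupConv (he.continuous i) (hu_int k)).aestronglyMeasurable.sub (hu k)) ?_
    filter_upwards [hsum] with x hx
    exact (hasSum_groupConv (he.continuous i) hu hL1 hsum x).sub hx
  have hdom : ∑' k, 2 * smallLebesgueGauge p θ μ (u k) ≠ ∞ := by
    rw [ENNReal.tsum_mul_left]
    exact ENNReal.mul_ne_top ENNReal.ofNat_ne_top hgauge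
  refine tendsto_of_tendsto_of_tendsto_of_le_of_le tendsto_const_nhds ?_ (fun _ => zero_le) hle
  exact tendsto_ennreal_tsum_zero_of_dominated hdom
    (fun i k => he.smallLebesgueGauge_groupConv_sub_self_le i (hu_int k))
    fun k => he.tendsto_smallLebesgueGauge_groupConv_sub_self (hu k)
      (ENNReal.ne_top_of_tsum_ne_top hgauge k)

theorem isSmallLebesgueApproxIdentity [Preorder ι] (he : IsDiracNet μ atTop e) (hp : 1 < p)
    (hθ : 0 ≤ θ) : IsSmallLebesgueApproxIdentity p θ μ e where
  mem i := memSmallLebesgue_of_continuous hp (he.continuous i)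
  bounded := ⟨1, fun i => (he.eLpNorm_one i).le⟩
  conv_exists _ hf i :=
    ae_of_all _ (convolutionExists_of_continuous (he.continuous i) (hf.integrable hp hθ))
  conv_mem _ hf i := memSmallLebesgue_of_continuous hp
    (continuous_groupConv (he.continuous i) (hf.integrable hp hθ))
  tendsto _ hf := he.tendsto_smallLebesgueNorm_groupConv_sub_self hp hθ hf

end IsDiracNet

theorem theorem5_general {G : Type u} [AddCommGroup G] [TopologicalSpace G]
    [IsTopologicalAddGroup G] [LocallyCompactSpace G] [MeasurableSpace G] [BorelSpace G]
    (μ : Measure G) [μ.IsAddHaarMeasure] [μ.Regular] [IsFiniteMeasure μ]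
    (p θ : ℝ) (hp : 1 < p) (hθ : 0 ≤ θ) :
    ∃ (I : Type u) (_ : Preorder I) (_ : IsDirectedOrder I) (_ : Nonempty I) (e : I → G → ℝ),
      IsSmallLebesgueApproxIdentity p θ μ e := by
  have : CompactSpace G := compactSpace_of_isFiniteMeasure μ
  obtain ⟨e, he⟩ := exists_isDiracNet_openNhdsOf μ
  exact ⟨(TopologicalSpace.OpenNhdsOf (0 : G))ᵒᵈ, inferInstance, inferInstance, inferInstance, e,
    he.isSmallLebesgueApproxIdentity hp hθ⟩

theorem theorem5 {G : Type u} [AddCommGroup G] [TopologicalSpace G] [IsTopologicalAddGroup G]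
    [LocallyCompactSpace G] [T2Space G] [MeasurableSpace G] [BorelSpace G]
    (μ : Measure G) [μ.IsAddHaarMeasure] [μ.Regular] [IsFiniteMeasure μ]
    (p θ : ℝ) (hp : 1 < p) (hθ : 0 ≤ θ) :
    ∃ (I : Type u) (_ : Preorder I) (_ : IsDirectedOrder I) (_ : Nonempty I) (e : I → G → ℝ),
      IsSmallLebesgueApproxIdentity p θ μ e :=
  theorem5_general μ p θ hp hθ
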